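/- Let $R$ be a commutative Artinian ring and let $\Lambda$ be an Artinian $R$-algebra, that is, an $R$-algebra which is finitely generated as an $R$-module. Let $$0\to \Lambda\to I^0(\Lambda)\to I^1(\Lambda)\to\cdots$$ be the minimal injective resolution of the left $\Lambda$-module $\Lambda$. Suppose that $\Lambda$ is nonzero and Auslander-regular, i.e. $\Lambda$ is left and right Noetherian, the flat dimension of $I^i(\Lambda)$ is at most $i$ for every $i\ge 0$, and the global dimension of $\Lambda$ is finite. Let $n\geq 0$ be the global dimension of $\Lambda$. Then there exists a simple left $\Lambda$-module $S_2$ of projective dimension $n$ and, if $n\ge 1$, there exists a simple left $\Lambda$-module $S_1$ of projective dimension $n-1$. -/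

import Mathlib

open CategoryTheory TensorProduct MulOpposite

universe u v

/-- The relations `xa ⊗ m = x ⊗ am` imposed on `X ⊗[ℤ] M`, for `X` a right and `M` a left
`Λ`-module. Right `Λ`-modules are modules over `Λᵐᵒᵖ`. -/
def balancedRelations (Λ : Type v) [Ring Λ] (X : Type v) [AddCommGroup X] [Module Λᵐᵒᵖ X]
    (M : Type v) [AddCommGroup M] [Module Λ M] : AddSubgroup (X ⊗[ℤ] M) :=
  AddSubgroup.closure
    {t | ∃ (x : X) (a : Λ) (m : M), t = (op a • x) ⊗ₜ[ℤ] m - x ⊗ₜ[ℤ] (a • m)}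

/-- The tensor product `X ⊗_Λ M` of a right `Λ`-module and a left `Λ`-module over a (not
necessarily commutative) ring `Λ`. -/
abbrev BalancedTensor (Λ : Type v) [Ring Λ] (X : Type v) [AddCommGroup X] [Module Λᵐᵒᵖ X]
    (M : Type v) [AddCommGroup M] [Module Λ M] : Type v :=
  (X ⊗[ℤ] M) ⧸ balancedRelations Λ X M

theorem balancedRelations_le_comap (Λ : Type v) [Ring Λ]
    {X Y : Type v} [AddCommGroup X] [Module Λᵐᵒᵖ X] [AddCommGroup Y] [Module Λᵐᵒᵖ Y]
    (f : X →ₗ[Λᵐᵒᵖ] Y) (M : Type v) [AddCommGroup M] [Module Λ M] :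
    balancedRelations Λ X M ≤ (balancedRelations Λ Y M).comap
      (LinearMap.rTensor M f.toAddMonoidHom.toIntLinearMap).toAddMonoidHom := by
  refine (AddSubgroup.closure_le _).2 ?_
  rintro _ ⟨x, a, m, rfl⟩
  refine AddSubgroup.subset_closure ⟨f x, a, m, ?_⟩
  simp

/-- The map `f ⊗ M : X ⊗_Λ M → Y ⊗_Λ M` induced by a map `f : X → Y` of right modules. -/
def BalancedTensor.map (Λ : Type v) [Ring Λ]
    {X Y : Type v} [AddCommGroup X] [Module Λᵐᵒᵖ X] [AddCommGroup Y] [Module Λᵐᵒᵖ Y]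
    (f : X →ₗ[Λᵐᵒᵖ] Y) (M : Type v) [AddCommGroup M] [Module Λ M] :
    BalancedTensor Λ X M →+ BalancedTensor Λ Y M :=
  QuotientAddGroup.map _ _
    (LinearMap.rTensor M f.toAddMonoidHom.toIntLinearMap).toAddMonoidHom
    (balancedRelations_le_comap Λ f M)

/-- A left `Λ`-module `M` is flat if `- ⊗_Λ M` preserves injections of right `Λ`-modules.
(Mathlib's `Module.Flat` is only available over commutative rings.) -/
def IsFlatModule (Λ : Type v) [Ring Λ] (M : Type v) [AddCommGroup M] [Module Λ M] : Prop :=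
  ∀ (X Y : Type v) [AddCommGroup X] [Module Λᵐᵒᵖ X] [AddCommGroup Y] [Module Λᵐᵒᵖ Y]
    (f : X →ₗ[Λᵐᵒᵖ] Y), Function.Injective f → Function.Injective (BalancedTensor.map Λ f M)

/-- `HasFlatDimensionLE Λ n M` means `fd M ≤ n`: there is an exact sequence
`0 → F_n → ⋯ → F_1 → F_0 → M → 0` with all `F_i` flat. The sequence is built one step at a time:
a surjection `p : F_0 → M` from a flat module whose kernel has such a resolution of length
`n - 1`. -/
def HasFlatDimensionLE (Λ : Type v) [Ring Λ] : ℕ → ModuleCat.{v} Λ → Prop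
  | 0, M => IsFlatModule Λ M
  | n + 1, M => ∃ (F : ModuleCat.{v} Λ) (p : F →ₗ[Λ] M), IsFlatModule Λ F ∧
      Function.Surjective p ∧ HasFlatDimensionLE Λ n (ModuleCat.of Λ (LinearMap.ker p))

/-- A submodule is essential if it meets every nonzero submodule nontrivially. -/
def IsEssentialSubmodule {Λ : Type v} [Ring Λ] {M : Type v} [AddCommGroup M] [Module Λ M]
    (N : Submodule Λ M) : Prop :=
  ∀ L : Submodule Λ M, L ≠ ⊥ → N ⊓ L ≠ ⊥

/-- A minimal injective resolution `0 → M → I⁰ → I¹ → ⋯` of a left `Λ`-module `M`: an exact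
sequence with all `Iⁱ` injective in which `Iⁱ` is an injective envelope of the image of the
preceding map, that is (by exactness), of the kernel of `Iⁱ → Iⁱ⁺¹`. -/
structure MinimalInjectiveResolution (Λ : Type v) [Ring Λ]
    (M : Type v) [AddCommGroup M] [Module Λ M] where
  I : ℕ → ModuleCat.{v} Λ
  ε : M →ₗ[Λ] I 0
  d : ∀ i : ℕ, I i →ₗ[Λ] I (i + 1)
  injective_I : ∀ i, Module.Injective Λ (I i)
  injective_ε : Function.Injective ε
  exact_zero : Function.Exact ε (d 0)
  exact_succ : ∀ i, Function.Exact (d i) (d (i + 1))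
  essential : ∀ i, IsEssentialSubmodule (LinearMap.ker (d i))

/-- A left and right Noetherian ring `Λ` is `n`-Gorenstein if `fd Iⁱ(Λ) ≤ i` for `0 ≤ i ≤ n - 1`,
where `0 → Λ → I⁰(Λ) → I¹(Λ) → ⋯` is the minimal injective resolution of the left module `Λ`
(it exists and is unique up to isomorphism). -/
def IsGorensteinUpTo (Λ : Type v) [Ring Λ] (n : ℕ) : Prop :=
  IsNoetherianRing Λ ∧ IsNoetherianRing Λᵐᵒᵖ ∧
    ∃ J : MinimalInjectiveResolution Λ Λ, ∀ i < n, HasFlatDimensionLE Λ i (J.I i)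

/-- The (left) global dimension of `Λ`: the supremum of the projective dimensions of all left
`Λ`-modules. It is `⊥` exactly for the zero ring. -/
noncomputable def globalDimension (Λ : Type v) [Ring Λ] : WithBot ℕ∞ :=
  ⨆ M : ModuleCat.{v} Λ, projectiveDimension M

/-- `Λ` is Auslander-regular if it is `n`-Gorenstein for all `n` and has finite global
dimension. -/
def IsAuslanderRegular (Λ : Type v) [Ring Λ] : Prop :=
  (∀ n : ℕ, IsGorensteinUpTo Λ n) ∧ globalDimension Λ < ⊤

/-! Let `m` be `n` or `n - 1`. Then `Iᵐ ≠ 0`: if the injective dimension of `Λ` were less than `n`,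
then, since over a Noetherian ring direct sums of injectives are injective, so would be that of
every `Λ^(N)`, hence that of its quotient `N`, because all injective dimensions are at most `n`;
but then the global dimension would be less than `n`.

A simple submodule `S ⊆ Iᵐ` has projective dimension exactly `m`.
* By essentiality `S` lies in the cosyzygy `Ker(Iᵐ → Iᵐ⁺¹)`. If `pd S < m`, then dimension shifting
  gives `Ext¹(S, Ker(Iᵐ⁻¹ → Iᵐ)) = 0`, so `S → Iᵐ` lifts to an embedding `S → Iᵐ⁻¹` whose image
  meets `Ker(Iᵐ⁻¹ → Iᵐ)` trivially, contradicting essentiality there.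
* In `0 → S → Iᵐ → Iᵐ/S → 0` we have `pd Iᵐ ≤ m` and `pd Iᵐ/S ≤ n ≤ m + 1`, so `pd S ≤ m`.

For `m = n` the bound `pd Iᵐ ≤ m` is clear, and for `m = n - 1` it follows from `fd Iᵐ ≤ m`, because
flat modules over `Λ` are projective: if `p : P → M` is a projective cover of a flat module with
kernel `K ⊆ JP`, where `J` is the (nilpotent) Jacobson radical, then injectivity of `J ⊗ M → M`
gives `K = JK`, so `K = 0`. -/

section NilpotentIdeal

variable {Λ M : Type*} [Ring Λ] [AddCommGroup M] [Module Λ M] {I : Ideal Λ}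

theorem eq_bot_of_le_smul_of_isNilpotent (hI : IsNilpotent I) {N : Submodule Λ M}
    (h : N ≤ I • N) : N = ⊥ := by
  obtain ⟨k, hk⟩ := hI
  have le_pow_smul (j : ℕ) : N ≤ I ^ j • N := by
    induction j with
    | zero => simp [Submodule.pow_zero, Ideal.one_eq_top]
    | succ j ih =>
      rw [Submodule.pow_succ, Submodule.mul_smul]
      exact ih.trans (Submodule.smul_mono le_rfl h)
  simpa [hk] using le_pow_smul k

theorem eq_top_of_sup_smul_top_of_isNilpotent (hI : IsNilpotent I) {N : Submodule Λ M}
    (h : N ⊔ I • ⊤ = ⊤) : N = ⊤ := by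
  have htop : (⊤ : Submodule Λ (M ⧸ N)) = I • ⊤ := by
    simpa [Submodule.map_sup, Submodule.map_smul''] using (congrArg (Submodule.map N.mkQ) h).symm
  rw [← N.ker_mkQ, LinearMap.ker_eq_top, ← LinearMap.range_eq_bot, N.range_mkQ]
  exact eq_bot_of_le_smul_of_isNilpotent hI htop.le

end NilpotentIdeal

section ProjectiveCover

variable {Λ F : Type*} [Ring Λ] [AddCommGroup F] [Module Λ F] (I : Ideal Λ)

/-- Reduction of endomorphisms of `F` modulo `IF`, along which idempotents are lifted. -/
def reduceEnd : Module.End Λ F →+* Module.End Λ (F ⧸ (I • ⊤ : Submodule Λ F)) where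
  toFun f := Submodule.mapQ _ _ f (Submodule.smul_top_le_comap_smul_top I f)
  map_one' := by ext; rfl
  map_mul' _ _ := by ext; rfl
  map_zero' := by ext; rfl
  map_add' _ _ := by ext; rfl

theorem reduceEnd_mk (f : Module.End Λ F) (x : F) :
    reduceEnd I f (Submodule.Quotient.mk x) = Submodule.Quotient.mk (f x) := rfl

theorem reduceEnd_surjective [Module.Projective Λ F] :
    Function.Surjective (reduceEnd (F := F) I) := by
  intro g
  obtain ⟨f, hf⟩ := Module.projective_lifting_property (Submodule.mkQ (I • ⊤ : Submodule Λ F))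
    (g ∘ₗ Submodule.mkQ _) (Submodule.mkQ_surjective _)
  refine ⟨f, ?_⟩
  ext x
  exact LinearMap.congr_fun hf x

variable {I}

theorem isNilpotent_of_mem_ker_reduceEnd (hI : IsNilpotent I) {f : Module.End Λ F}
    (hf : f ∈ RingHom.ker (reduceEnd (F := F) I)) : IsNilpotent f := by
  obtain ⟨k, hk⟩ := hI
  have range_le : LinearMap.range f ≤ I • ⊤ := by
    rintro _ ⟨x, rfl⟩
    rw [← Submodule.Quotient.mk_eq_zero, ← reduceEnd_mk, RingHom.mem_ker.1 hf,
      LinearMap.zero_apply]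
  have range_pow_le (j : ℕ) : LinearMap.range (f ^ j) ≤ I ^ j • ⊤ := by
    induction j with
    | zero => simp [Submodule.pow_zero, Ideal.one_eq_top]
    | succ j ih =>
      rw [pow_succ', Module.End.mul_eq_comp, LinearMap.range_comp]
      refine (Submodule.map_mono ih).trans ?_
      rw [Submodule.map_smul'', Submodule.map_top, Submodule.pow_succ, Submodule.mul_smul]
      exact Submodule.smul_mono le_rfl range_le
  refine ⟨k, LinearMap.range_eq_bot.1 (le_bot_iff.1 ?_)⟩
  simpa [hk] using range_pow_le k

theorem exists_isIdempotentElem_comap_eq [Module.Projective Λ F]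
    [IsSemisimpleModule Λ (F ⧸ (I • ⊤ : Submodule Λ F))] (hI : IsNilpotent I)
    {N : Submodule Λ F} (hN : I • ⊤ ≤ N) :
    ∃ e : Module.End Λ F, IsIdempotentElem e ∧ (I • ⊤ : Submodule Λ F).comap e = N := by
  obtain ⟨C, hC⟩ := exists_isCompl (N.map (I • ⊤ : Submodule Λ F).mkQ)
  obtain ⟨e, he, hred⟩ := exists_isIdempotentElem_eq_of_ker_isNilpotent (reduceEnd I)
    (fun _ ↦ isNilpotent_of_mem_ker_reduceEnd hI) (Submodule.projection _ _ hC.symm)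
    (reduceEnd_surjective I _) (Submodule.isIdempotentElem_projection hC.symm)
  refine ⟨e, he, ?_⟩
  ext x
  rw [Submodule.mem_comap, ← Submodule.Quotient.mk_eq_zero, ← reduceEnd_mk, hred,
    Submodule.projection_apply_eq_zero_iff, ← Submodule.mkQ_apply, ← Submodule.mem_comap,
    Submodule.comap_map_mkQ, sup_eq_right.2 hN]

theorem exists_projective_submodule_surjective_ker_le [Module.Projective Λ F]
    [IsSemisimpleModule Λ (F ⧸ (I • ⊤ : Submodule Λ F))] (hI : IsNilpotent I)
    {M : Type*} [AddCommGroup M] [Module Λ M] {π : F →ₗ[Λ] M} (hπ : Function.Surjective π) :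
    ∃ P : Submodule Λ F, Module.Projective Λ P ∧ Function.Surjective (π.domRestrict P) ∧
      LinearMap.ker (π.domRestrict P) ≤ I • ⊤ := by
  obtain ⟨e, he, heN⟩ := exists_isIdempotentElem_comap_eq hI
    (Submodule.smul_top_le_comap_smul_top I π)
  have e_e (x : F) : e (e x) = e x := LinearMap.congr_fun he x
  refine ⟨LinearMap.range e, ?_, ?_, ?_⟩
  · refine Module.Projective.of_split (LinearMap.range e).subtype e.rangeRestrict ?_
    ext ⟨_, x, rfl⟩
    exact e_e x
  · refine LinearMap.range_eq_top.1 (eq_top_of_sup_smul_top_of_isNilpotent hI (top_le_iff.1 ?_))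
    intro m _
    obtain ⟨x, rfl⟩ := hπ m
    have sub_mem : x - e x ∈ (I • ⊤ : Submodule Λ M).comap π := by
      simp [← heN, e_e]
    rw [← add_sub_cancel (π (e x)) (π x), ← map_sub]
    exact Submodule.add_mem_sup ⟨⟨e x, x, rfl⟩, rfl⟩ sub_mem
  · rintro ⟨_, x, rfl⟩ hx
    have e_x_mem : e x ∈ (I • ⊤ : Submodule Λ F) := by
      have : e x ∈ (I • ⊤ : Submodule Λ M).comap π := by
        rw [Submodule.mem_comap, show π (e x) = 0 from hx]
        exact zero_mem _
      rwa [← heN, Submodule.mem_comap, e_e] at this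
    have rangeRestrict_eq : e.rangeRestrict (e x) = ⟨e x, x, rfl⟩ := Subtype.ext (e_e x)
    rw [← rangeRestrict_eq]
    exact Submodule.smul_top_le_comap_smul_top I e.rangeRestrict e_x_mem

end ProjectiveCover

theorem isSemisimpleModule_quotient_jacobson_smul_top {Λ : Type*} [Ring Λ] [IsSemiprimaryRing Λ]
    (M : Type*) [AddCommGroup M] [Module Λ M] :
    IsSemisimpleModule Λ (M ⧸ (Ring.jacobson Λ • ⊤ : Submodule Λ M)) := by
  have h : Module.IsTorsionBySet Λ (M ⧸ (Ring.jacobson Λ • ⊤ : Submodule Λ M))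
      (Ring.jacobson Λ) := by
    rw [Module.isTorsionBySet_quotient_iff]
    exact fun m i hi ↦ Submodule.smul_mem_smul hi trivial
  let _ := h.module
  exact (h.semilinearMap.isSemisimpleModule_iff_of_bijective Function.bijective_id).2
    inferInstance

namespace BalancedTensor

variable {Λ : Type v} [Ring Λ] {X Y : Type v} [AddCommGroup X] [Module Λᵐᵒᵖ X]
  [AddCommGroup Y] [Module Λᵐᵒᵖ Y] {M N P : Type v} [AddCommGroup M] [Module Λ M]
  [AddCommGroup N] [Module Λ N] [AddCommGroup P] [Module Λ P]

variable (Λ) in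
/-- The pure tensor `x ⊗ m` in `X ⊗_Λ M`. -/
def tmul (x : X) (m : M) : BalancedTensor Λ X M :=
  QuotientAddGroup.mk (x ⊗ₜ[ℤ] m)

theorem smul_tmul (x : X) (a : Λ) (m : M) : tmul Λ (op a • x) m = tmul Λ x (a • m) :=
  QuotientAddGroup.eq_iff_sub_mem.2 (AddSubgroup.subset_closure ⟨x, a, m, rfl⟩)

variable (M) in
theorem tmul_zero (x : X) : tmul Λ x (0 : M) = 0 := by
  simp only [tmul, TensorProduct.tmul_zero, QuotientAddGroup.mk_zero]

theorem tmul_add (x : X) (m m' : M) : tmul Λ x (m + m') = tmul Λ x m + tmul Λ x m' := by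
  simp only [tmul, TensorProduct.tmul_add, QuotientAddGroup.mk_add]

@[elab_as_elim]
theorem induction_on {motive : BalancedTensor Λ X M → Prop} (z : BalancedTensor Λ X M)
    (zero : motive 0) (tmul : ∀ x m, motive (tmul Λ x m))
    (add : ∀ y z, motive y → motive z → motive (y + z)) : motive z := by
  obtain ⟨t, rfl⟩ := QuotientAddGroup.mk_surjective z
  induction t with
  | zero => exact zero
  | tmul x m => exact tmul x m
  | add s t hs ht => exact add _ _ hs ht

theorem map_tmul (f : X →ₗ[Λᵐᵒᵖ] Y) (x : X) (m : M) :
    map Λ f M (tmul Λ x m) = tmul Λ (f x) m := rfl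

variable (X) in
/-- The map `X ⊗_Λ p : X ⊗_Λ M → X ⊗_Λ N` induced by a map `p : M → N` of left modules. -/
def lmap (p : M →ₗ[Λ] N) : BalancedTensor Λ X M →+ BalancedTensor Λ X N :=
  QuotientAddGroup.map _ _
    (LinearMap.lTensor X p.toAddMonoidHom.toIntLinearMap).toAddMonoidHom <| by
      refine (AddSubgroup.closure_le _).2 ?_
      rintro _ ⟨x, a, m, rfl⟩
      exact AddSubgroup.subset_closure ⟨x, a, p m, by simp⟩

theorem lmap_tmul (p : M →ₗ[Λ] N) (x : X) (m : M) :
    lmap X p (tmul Λ x m) = tmul Λ x (p m) := rfl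

variable (X) in
theorem balancedRelations_le_map_lTensor {p : M →ₗ[Λ] N} (hp : Function.Surjective p) :
    balancedRelations Λ X N ≤ (balancedRelations Λ X M).map
      (LinearMap.lTensor X p.toAddMonoidHom.toIntLinearMap).toAddMonoidHom := by
  refine (AddSubgroup.closure_le _).2 ?_
  rintro _ ⟨x, a, n, rfl⟩
  obtain ⟨m, rfl⟩ := hp n
  exact ⟨_, AddSubgroup.subset_closure ⟨x, a, m, rfl⟩, by simp⟩

theorem exists_lmap_eq {j : M →ₗ[Λ] N} {p : N →ₗ[Λ] P} (hjp : Function.Exact j p)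
    (hp : Function.Surjective p) {z : BalancedTensor Λ X N} (hz : lmap X p z = 0) :
    ∃ w, lmap X j w = z := by
  obtain ⟨t, rfl⟩ := QuotientAddGroup.mk_surjective z
  obtain ⟨s, hs, hst⟩ :=
    balancedRelations_le_map_lTensor X hp ((QuotientAddGroup.eq_zero_iff _).1 hz)
  obtain ⟨w, hw⟩ := (lTensor_exact X (f := j.toAddMonoidHom.toIntLinearMap)
    (g := p.toAddMonoidHom.toIntLinearMap) hjp hp (t - s)).1
    ((map_sub _ _ _).trans (sub_eq_zero.2 hst.symm))
  refine ⟨QuotientAddGroup.mk w, ?_⟩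
  calc lmap X j (QuotientAddGroup.mk w) = QuotientAddGroup.mk (t - s) := congrArg _ hw
    _ = QuotientAddGroup.mk t := QuotientAddGroup.eq_iff_sub_mem.2 (by simpa using hs)

/-- The action `I ⊗_Λ M → M`, `a ⊗ m ↦ am`, of a right ideal `I` on a left module `M`. -/
noncomputable def act (I : Submodule Λᵐᵒᵖ Λ) (M : Type v) [AddCommGroup M] [Module Λ M] :
    BalancedTensor Λ I M →+ M :=
  QuotientAddGroup.lift _
    (TensorProduct.liftAddHom ((smulAddHom Λ M).comp I.subtype.toAddMonoidHom) fun c a m ↦ by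
      simp only [map_zsmul, AddMonoidHom.smul_apply]) <| by
      refine (AddSubgroup.closure_le _).2 ?_
      rintro _ ⟨x, a, m, rfl⟩
      simp [smul_smul]

variable (I : Submodule Λᵐᵒᵖ Λ)

theorem act_tmul (a : I) (m : M) : act I M (tmul Λ a m) = (a : Λ) • m := rfl

theorem act_lmap (p : M →ₗ[Λ] N) (z : BalancedTensor Λ I M) :
    act I N (lmap I p z) = p (act I M z) := by
  induction z using induction_on with
  | zero => simp only [map_zero]
  | tmul a m => rw [lmap_tmul, act_tmul, act_tmul, map_smul]
  | add y z hy hz => simp only [map_add, hy, hz]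

theorem map_subtype_eq_tmul_act (z : BalancedTensor Λ I M) :
    map Λ I.subtype M z = tmul Λ 1 (act I M z) := by
  induction z using induction_on with
  | zero => rw [map_zero, map_zero, tmul_zero]
  | tmul a m => rw [map_tmul, act_tmul, ← smul_tmul, op_smul_eq_mul, one_mul, I.subtype_apply]
  | add y z hy hz => rw [map_add, map_add, tmul_add, hy, hz]

theorem act_injective (hM : IsFlatModule Λ M) : Function.Injective (act I M) := fun y z h ↦
  hM I Λ I.subtype Subtype.val_injective <| by
    rw [map_subtype_eq_tmul_act, map_subtype_eq_tmul_act, h]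

end BalancedTensor

section Flat

variable {Λ : Type v} [Ring Λ]

/-- A two-sided ideal regarded as a right ideal, that is, as a `Λᵐᵒᵖ`-submodule of `Λ`. -/
def toRightIdeal (I : Ideal Λ) [I.IsTwoSided] : Submodule Λᵐᵒᵖ Λ where
  carrier := I
  add_mem' := I.add_mem
  zero_mem' := I.zero_mem
  smul_mem' a _ hx := I.mul_mem_right a.unop hx

theorem BalancedTensor.range_act (I : Ideal Λ) [I.IsTwoSided] (M : Type v) [AddCommGroup M]
    [Module Λ M] :
    (act (toRightIdeal I) M).range = (I • ⊤ : Submodule Λ M).toAddSubgroup := by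
  refine le_antisymm ?_ fun x hx ↦ ?_
  · rintro _ ⟨z, rfl⟩
    induction z using induction_on with
    | zero => rw [map_zero]; exact zero_mem _
    | tmul a m => exact Submodule.smul_mem_smul a.2 trivial
    | add y z hy hz => rw [map_add]; exact add_mem hy hz
  · refine Submodule.smul_induction_on hx (fun a ha m _ ↦ ?_) fun _ _ ↦ add_mem
    exact ⟨tmul Λ (⟨a, ha⟩ : toRightIdeal I) m, rfl⟩

theorem IsFlatModule.ker_le_smul_ker {P M : Type v} [AddCommGroup P] [Module Λ P]
    [AddCommGroup M] [Module Λ M] (hM : IsFlatModule Λ M) {p : P →ₗ[Λ] M}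
    (hp : Function.Surjective p) {I : Ideal Λ} [I.IsTwoSided]
    (hI : LinearMap.ker p ≤ I • ⊤) : LinearMap.ker p ≤ I • LinearMap.ker p := by
  intro x hx
  obtain ⟨z, rfl⟩ := (BalancedTensor.range_act I P).ge (hI hx)
  have lmap_eq_zero : BalancedTensor.lmap (toRightIdeal I) p z = 0 :=
    BalancedTensor.act_injective _ hM <| by
      rw [BalancedTensor.act_lmap, map_zero]
      exact hx
  obtain ⟨w, rfl⟩ := BalancedTensor.exists_lmap_eq p.exact_subtype_ker_map hp lmap_eq_zero
  have act_w_mem : BalancedTensor.act _ _ w ∈ (I • ⊤ : Submodule Λ (LinearMap.ker p)) :=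
    (BalancedTensor.range_act I _).le ⟨w, rfl⟩
  have := Submodule.mem_map_of_mem (f := (LinearMap.ker p).subtype) act_w_mem
  rwa [Submodule.map_smul'', Submodule.map_top, Submodule.range_subtype,
    ← BalancedTensor.act_lmap] at this

theorem IsFlatModule.projective_of_surjective {F M : Type v} [AddCommGroup F] [Module Λ F]
    [Module.Projective Λ F] [AddCommGroup M] [Module Λ M] (hM : IsFlatModule Λ M)
    {I : Ideal Λ} [I.IsTwoSided] (hI : IsNilpotent I)
    [IsSemisimpleModule Λ (F ⧸ (I • ⊤ : Submodule Λ F))] {π : F →ₗ[Λ] M}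
    (hπ : Function.Surjective π) : Module.Projective Λ M := by
  obtain ⟨P, _, hp, hker⟩ := exists_projective_submodule_surjective_ker_le hI hπ
  have ker_eq_bot := eq_bot_of_le_smul_of_isNilpotent hI (hM.ker_le_smul_ker hp hker)
  exact .of_equiv (.ofBijective (π.domRestrict P) ⟨LinearMap.ker_eq_bot.1 ker_eq_bot, hp⟩)

theorem IsFlatModule.projective [IsSemiprimaryRing Λ] {M : Type v} [AddCommGroup M] [Module Λ M]
    (hM : IsFlatModule Λ M) : Module.Projective Λ M :=
  have := isSemisimpleModule_quotient_jacobson_smul_top (Λ := Λ) (M →₀ Λ)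
  hM.projective_of_surjective IsSemiprimaryRing.isNilpotent
    (Finsupp.linearCombination_id_surjective Λ M)

theorem HasFlatDimensionLE.hasProjectiveDimensionLE [IsSemiprimaryRing Λ] {n : ℕ}
    {M : ModuleCat.{v} Λ} (h : HasFlatDimensionLE Λ n M) : HasProjectiveDimensionLE M n := by
  induction n generalizing M with
  | zero =>
    have := IsFlatModule.projective h
    exact (projective_iff_hasProjectiveDimensionLE_zero M).1
      ((IsProjective.iff_projective (R := Λ) M).1 this)
  | succ n ih =>
    obtain ⟨F, p, hF, hp, hK⟩ := h
    have := (IsProjective.iff_projective (R := Λ) F).1 hF.projective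
    exact (LinearMap.shortExact_shortComplexKer hp).hasProjectiveDimensionLT_X₃ (n + 1) (ih hK)
      (inferInstanceAs (HasProjectiveDimensionLT F (n + 1 + 1)))

end Flat

section InjectiveDimension

variable {Λ : Type v} [Ring Λ]

theorem exists_finset_le_supported_of_fg {R ι M : Type*} [Ring R] [AddCommGroup M] [Module R M]
    {N : Submodule R (ι →₀ M)} (hN : N.FG) :
    ∃ s : Finset ι, N ≤ Finsupp.supported M R (s : Set ι) := by
  classical
  obtain ⟨t, rfl⟩ := hN
  exact ⟨t.biUnion Finsupp.support, by
    simpa using Finsupp.span_le_supported_biUnion_support (R := R) (t : Set (ι →₀ M))⟩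

theorem exact_finsupp_mapRange {R M N P : Type*} [Ring R] [AddCommGroup M] [Module R M]
    [AddCommGroup N] [Module R N] [AddCommGroup P] [Module R P] {f : M →ₗ[R] N} {g : N →ₗ[R] P}
    (hf : Function.Injective f) (hfg : Function.Exact f g) (ι : Type*) :
    Function.Exact (Finsupp.mapRange.linearMap (α := ι) f) (Finsupp.mapRange.linearMap g) := by
  rw [LinearMap.exact_iff, Finsupp.ker_mapRange, hfg.linearMap_ker_eq,
    Finsupp.range_mapRange_linearMap _ (LinearMap.ker_eq_bot.2 hf)]

theorem injective_finsupp [IsNoetherianRing Λ] (ι Q : Type v) [AddCommGroup Q] [Module Λ Q]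
    [hQ : Module.Injective Λ Q] : Module.Injective Λ (ι →₀ Q) := by
  refine Module.Baer.injective fun I g ↦ ?_
  obtain ⟨s, hs⟩ := exists_finset_le_supported_of_fg (Module.Finite.iff_fg.1 (.range g))
  choose h hh using fun i ↦ Module.Baer.of_injective hQ I (Finsupp.lapply i ∘ₗ g)
  have h_eq_zero {x : Λ} (hx : x ∈ I) (i : ι) (hi : i ∉ s) : h i x = 0 :=
    (hh i x hx).trans ((Finsupp.mem_supported' Λ _).1 (hs ⟨_, rfl⟩) i hi)
  refine ⟨∑ i ∈ s, Finsupp.lsingle i ∘ₗ h i, fun x hx ↦ ?_⟩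
  ext i
  classical
  calc (∑ j ∈ s, Finsupp.lsingle j ∘ₗ h j) x i = if i ∈ s then h i x else 0 := by
        simp [Finsupp.single_apply]
    _ = h i x := ite_eq_left_iff.2 fun hi ↦ (h_eq_zero hx i hi).symm
    _ = g ⟨x, hx⟩ i := hh i x hx

theorem injective_object_finsupp [IsNoetherianRing Λ] (ι : Type v) (Q : ModuleCat.{v} Λ)
    (hQ : Injective Q) : Injective (ModuleCat.of Λ (ι →₀ Q)) := by
  rw [← Module.injective_iff_injective_object] at hQ ⊢
  exact injective_finsupp ι Q

theorem hasInjectiveDimensionLT_finsupp [IsNoetherianRing Λ] {M : ModuleCat.{v} Λ} {n : ℕ}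
    (h : HasInjectiveDimensionLT M n) (ι : Type v) :
    HasInjectiveDimensionLT (ModuleCat.of Λ (ι →₀ M)) n := by
  induction n using Nat.twoStepInduction generalizing M with
  | zero =>
    have := ModuleCat.isZero_iff_subsingleton.1 (isZero_of_hasInjectiveDimensionLT_zero M)
    exact (ModuleCat.isZero_of_subsingleton _).hasInjectiveDimensionLT_zero
  | one =>
    rw [← injective_iff_hasInjectiveDimensionLT_one] at h ⊢
    exact injective_object_finsupp ι M h
  | more n _ ih =>
    obtain ⟨Q, hQ, f, hf⟩ := EnoughInjectives.presentation M
    have hf : Function.Injective f.hom := (ModuleCat.mono_iff_injective f).1 hf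
    have hex := f.hom.exact_map_mkQ_range
    have hS := ModuleCat.shortComplex_shortExact
      (ModuleCat.shortComplexOfCompEqZero _ _ hex.linearMap_comp_eq_zero) hex hf
      (Submodule.mkQ_surjective _)
    have hex_finsupp := exact_finsupp_mapRange hf hex ι
    have hS_finsupp := ModuleCat.shortComplex_shortExact
      (ModuleCat.shortComplexOfCompEqZero _ _ hex_finsupp.linearMap_comp_eq_zero) hex_finsupp
      (Finsupp.mapRange_injective _ (map_zero _) hf)
      (Finsupp.mapRange_surjective _ (map_zero _) (Submodule.mkQ_surjective _))
    exact (hS_finsupp.hasInjectiveDimensionLT_X₃_iff n (injective_object_finsupp ι Q hQ)).1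
      (ih ((hS.hasInjectiveDimensionLT_X₃_iff n hQ).2 h))

theorem hasProjectiveDimensionLT_of_hasInjectiveDimensionLT_self [IsNoetherianRing Λ] {n : ℕ}
    (hgl : ∀ M : ModuleCat.{v} Λ, HasProjectiveDimensionLT M (n + 1))
    (h : HasInjectiveDimensionLT (ModuleCat.of Λ Λ) n) (M : ModuleCat.{v} Λ) :
    HasProjectiveDimensionLT M n := by
  have id_lt_succ (N : ModuleCat.{v} Λ) : HasInjectiveDimensionLT N (n + 1) :=
    HasInjectiveDimensionLT.mk fun i hi Y e ↦ by
      have := hgl Y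
      exact e.eq_zero_of_hasProjectiveDimensionLT (n + 1) hi
  have id_lt (N : ModuleCat.{v} Λ) : HasInjectiveDimensionLT N n :=
    (LinearMap.shortExact_shortComplexKer
      (Finsupp.linearCombination_id_surjective Λ N)).hasInjectiveDimensionLT_X₃ n
      (hasInjectiveDimensionLT_finsupp h N) (id_lt_succ _)
  refine HasProjectiveDimensionLT.mk fun i hi N e ↦ ?_
  have := id_lt N
  exact e.eq_zero_of_hasInjectiveDimensionLT n hi

theorem globalDimension_lt_iff {n : ℕ} :
    globalDimension Λ < n ↔ ∀ M : ModuleCat.{v} Λ, HasProjectiveDimensionLT M n := by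
  simp_rw [← projectiveDimension_lt_iff]
  refine ⟨fun h M ↦ (le_iSup _ M).trans_lt h, fun h ↦ ?_⟩
  cases n with
  | zero =>
    simp only [Nat.cast_zero, WithBot.lt_zero_iff_eq_bot] at h ⊢
    exact iSup_eq_bot.2 h
  | succ n =>
    simp only [Nat.cast_succ, ENat.WithBot.lt_add_one_iff] at h ⊢
    exact iSup_le h

end InjectiveDimension

theorem IsEssentialSubmodule.simple_le {Λ : Type v} [Ring Λ] {M : Type v} [AddCommGroup M]
    [Module Λ M] {N : Submodule Λ M} (hN : IsEssentialSubmodule N) (S : Submodule Λ M)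
    [IsSimpleModule Λ S] : S ≤ N := by
  have hS : IsAtom S := isSimpleModule_iff_isAtom.1 inferInstance
  exact inf_eq_right.1 ((hS.le_iff.1 inf_le_right).resolve_left (hN S hS.1))

theorem exists_simple_submodule (Λ M : Type*) [Ring Λ] [IsArtinianRing Λ] [AddCommGroup M]
    [Module Λ M] [Nontrivial M] : ∃ S : Submodule Λ M, IsSimpleModule Λ S := by
  obtain ⟨x, hx⟩ := exists_ne (0 : M)
  have : IsArtinian Λ (Submodule.span Λ {x}) :=
    isArtinian_span_of_finite Λ (Set.finite_singleton x)
  have : Nontrivial (Submodule.span Λ {x}) := Submodule.nontrivial_span_singleton hx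
  obtain ⟨T, hT⟩ := IsAtomic.exists_atom (Submodule Λ (Submodule.span Λ {x}))
  have : IsSimpleModule Λ T := isSimpleModule_iff_isAtom.2 hT
  exact ⟨T.map (Submodule.subtype _), .congr
    (Submodule.equivMapOfInjective _ (Submodule.injective_subtype _) T).symm⟩

namespace MinimalInjectiveResolution

section

variable {Λ : Type v} [Ring Λ] {M : Type v} [AddCommGroup M] [Module Λ M]
  (J : MinimalInjectiveResolution Λ M)

theorem injective_object (i : ℕ) : Injective (J.I i) :=
  (Module.injective_iff_injective_object Λ (J.I i)).1 (J.injective_I i)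

/-- The `i`-th cosyzygy of `M`, encoded as the kernel of `Iⁱ → Iⁱ⁺¹`; the zeroth one is `M`. -/
abbrev cosyzygy (i : ℕ) : ModuleCat.{v} Λ := ModuleCat.of Λ (LinearMap.ker (J.d i))

/-- The differential `Iⁱ → Iⁱ⁺¹` corestricted to its image, the `(i + 1)`-st cosyzygy. -/
def toCosyzygy (i : ℕ) : J.I i →ₗ[Λ] LinearMap.ker (J.d (i + 1)) :=
  (J.d i).codRestrict _ fun x ↦ (J.exact_succ i _).2 ⟨x, rfl⟩

theorem toCosyzygy_surjective (i : ℕ) : Function.Surjective (J.toCosyzygy i) := by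
  rintro ⟨y, hy⟩
  obtain ⟨x, rfl⟩ := (J.exact_succ i y).1 hy
  exact ⟨x, rfl⟩

theorem exact_toCosyzygy (i : ℕ) :
    Function.Exact (LinearMap.ker (J.d i)).subtype (J.toCosyzygy i) := by
  rw [LinearMap.exact_iff, Submodule.range_subtype]
  exact LinearMap.ker_codRestrict _ _ _

theorem shortExact (i : ℕ) :
    (ModuleCat.shortComplexOfCompEqZero (R := Λ) (LinearMap.ker (J.d i)).subtype
      (J.toCosyzygy i) (J.exact_toCosyzygy i).linearMap_comp_eq_zero).ShortExact :=
  ModuleCat.shortComplex_shortExact _ (J.exact_toCosyzygy i) Subtype.val_injective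
    (J.toCosyzygy_surjective i)

theorem subsingleton_ext_cosyzygy (X : ModuleCat.{v} Λ) (i j : ℕ)
    (h : Subsingleton (Abelian.Ext X (J.cosyzygy 0) (i + j + 1))) :
    Subsingleton (Abelian.Ext X (J.cosyzygy i) (j + 1)) := by
  induction i generalizing j with
  | zero => rwa [zero_add] at h
  | succ i ih =>
    have := ih (j + 1) (by rwa [show i + (j + 1) + 1 = i + 1 + j + 1 by lia])
    have := J.injective_object i
    refine subsingleton_of_forall_eq 0 fun a ↦ ?_
    obtain ⟨y, rfl⟩ := Abelian.Ext.covariant_sequence_exact₃ X (J.shortExact i) a rfl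
      (Subsingleton.elim _ _)
    rw [y.eq_zero_of_injective, Abelian.Ext.zero_comp]

theorem exists_toCosyzygy_comp_eq {X : ModuleCat.{v} Λ} {m : ℕ}
    [HasProjectiveDimensionLT X (m + 1)] (f : X →ₗ[Λ] LinearMap.ker (J.d (m + 1))) :
    ∃ s : X →ₗ[Λ] J.I m, J.toCosyzygy m ∘ₗ s = f := by
  have := J.subsingleton_ext_cosyzygy X m 0
    (HasProjectiveDimensionLT.subsingleton _ (m + 1) _ le_rfl _)
  obtain ⟨x, hx⟩ := Abelian.Ext.covariant_sequence_exact₃ X (J.shortExact m)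
    (Abelian.Ext.mk₀ (ModuleCat.ofHom f)) (zero_add 1) (Subsingleton.elim _ _)
  obtain ⟨s, rfl⟩ := Abelian.Ext.homEquiv₀.symm.surjective x
  have hs : s ≫ ModuleCat.ofHom (J.toCosyzygy m) = ModuleCat.ofHom f :=
    Abelian.Ext.homEquiv₀.symm.injective (by simpa using hx)
  exact ⟨s.hom, congrArg ModuleCat.Hom.hom hs⟩

theorem not_hasProjectiveDimensionLT (m : ℕ) (S : Submodule Λ (J.I m)) [IsSimpleModule Λ S] :
    ¬ HasProjectiveDimensionLT (ModuleCat.of Λ S) m := by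
  intro h
  have := IsSimpleModule.nontrivial Λ S
  cases m with
  | zero =>
    exact not_subsingleton S (ModuleCat.isZero_iff_subsingleton.1
      (isZero_of_hasProjectiveDimensionLT_zero (ModuleCat.of Λ S)))
  | succ m =>
    obtain ⟨s, hs⟩ := J.exists_toCosyzygy_comp_eq (X := ModuleCat.of Λ S)
      (Submodule.inclusion ((J.essential (m + 1)).simple_le S))
    have d_s (y : S) : J.d m (s y) = y := congrArg Subtype.val (LinearMap.congr_fun hs y)
    have s_injective : Function.Injective s := fun a b hab ↦ by
      rw [← Subtype.val_inj, ← d_s, ← d_s, hab]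
    have : IsSimpleModule Λ (LinearMap.range s) := .congr (.symm (.ofInjective s s_injective))
    have range_le_ker := (J.essential m).simple_le (LinearMap.range s)
    obtain ⟨y, hy⟩ := exists_ne (0 : S)
    exact hy (Subtype.ext ((d_s y).symm.trans (range_le_ker ⟨y, rfl⟩)))

theorem hasInjectiveDimensionLT_cosyzygy (i j : ℕ)
    (h : HasInjectiveDimensionLT (J.cosyzygy (i + j)) 0) :
    HasInjectiveDimensionLT (J.cosyzygy i) j := by
  induction j generalizing i with
  | zero => exact h
  | succ j ih =>
    have := J.injective_object i
    exact (J.shortExact i).hasInjectiveDimensionLT_X₁ j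
      (ih (i + 1) (by rwa [show i + 1 + j = i + (j + 1) by lia]))
      (inferInstanceAs (HasInjectiveDimensionLT (J.I i) (j + 1)))

theorem hasInjectiveDimensionLT_of_subsingleton (m : ℕ) [Subsingleton (J.I m)] :
    HasInjectiveDimensionLT (ModuleCat.of Λ M) m := by
  have : HasInjectiveDimensionLT (J.cosyzygy 0) m := by
    refine J.hasInjectiveDimensionLT_cosyzygy 0 m ?_
    rw [zero_add]
    exact (ModuleCat.isZero_of_subsingleton (J.cosyzygy m)).hasInjectiveDimensionLT_zero
  let e : M ≃ₗ[Λ] LinearMap.ker (J.d 0) :=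
    (LinearEquiv.ofInjective J.ε J.injective_ε).trans
      (LinearEquiv.ofEq _ _ J.exact_zero.linearMap_ker_eq.symm)
  exact hasInjectiveDimensionLT_of_iso e.symm.toModuleIso m

end

section

variable {Λ : Type v} [Ring Λ] (J : MinimalInjectiveResolution Λ Λ) {m n : ℕ}

theorem nontrivial_of_le_globalDimension [IsNoetherianRing Λ] (hn : globalDimension Λ = n)
    (hm : m ≤ n) : Nontrivial (J.I m) := by
  rw [← not_subsingleton_iff_nontrivial]
  intro _
  have id_lt : HasInjectiveDimensionLT (ModuleCat.of Λ Λ) n :=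
    have := J.hasInjectiveDimensionLT_of_subsingleton m
    hasInjectiveDimensionLT_of_ge _ m n hm
  have pd_lt : ∀ X : ModuleCat.{v} Λ, HasProjectiveDimensionLT X (n + 1) :=
    globalDimension_lt_iff.1 (hn.trans_lt (by exact_mod_cast n.lt_succ_self))
  exact hn.not_lt <| globalDimension_lt_iff.2 <|
    hasProjectiveDimensionLT_of_hasInjectiveDimensionLT_self pd_lt id_lt

theorem exists_simple_projectiveDimension_eq [IsArtinianRing Λ] (hn : globalDimension Λ = n)
    (hmn : m ≤ n) (hnm : n ≤ m + 1) (hm : HasProjectiveDimensionLE (J.I m) m) :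
    ∃ S : ModuleCat.{v} Λ, IsSimpleModule Λ S ∧ projectiveDimension S = m := by
  have := J.nontrivial_of_le_globalDimension hn hmn
  obtain ⟨S, hS⟩ := exists_simple_submodule Λ (J.I m)
  refine ⟨ModuleCat.of Λ S, hS, le_antisymm ?_
    ((projectiveDimension_ge_iff _ m).2 (J.not_hasProjectiveDimensionLT m S))⟩
  have hex := LinearMap.exact_subtype_mkQ S
  have shortExact := ModuleCat.shortComplex_shortExact
    (ModuleCat.shortComplexOfCompEqZero _ _ hex.linearMap_comp_eq_zero) hex
    Subtype.val_injective S.mkQ_surjective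
  have pd_lt := (globalDimension_lt_iff (n := m + 2)).1
    (hn.trans_lt (by exact_mod_cast Nat.lt_succ_of_le hnm))
  rw [projectiveDimension_le_iff]
  exact shortExact.hasProjectiveDimensionLT_X₁ (m + 1) hm (pd_lt _)

end

end MinimalInjectiveResolution

theorem proposition3p6_general {Λ : Type v} [Ring Λ] [IsArtinianRing Λ]
    (J : MinimalInjectiveResolution Λ Λ) {n : ℕ} (hn : globalDimension Λ = n)
    (hJ : ∀ i, i + 1 = n → HasFlatDimensionLE Λ i (J.I i)) :
    (1 ≤ n → ∃ S₁ : ModuleCat.{v} Λ, IsSimpleModule Λ S₁ ∧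
      projectiveDimension S₁ = ((n - 1 : ℕ) : WithBot ℕ∞)) ∧
    (∃ S₂ : ModuleCat.{v} Λ, IsSimpleModule Λ S₂ ∧ projectiveDimension S₂ = n) := by
  refine ⟨fun h ↦ ?_, ?_⟩
  · exact J.exists_simple_projectiveDimension_eq hn (by lia) (by lia)
      (hJ (n - 1) (by lia)).hasProjectiveDimensionLE
  · exact J.exists_simple_projectiveDimension_eq hn le_rfl (by lia)
      ((projectiveDimension_le_iff _ n).1 (hn ▸ le_iSup _ _))

theorem proposition3p6 (R : Type u) [CommRing R] [IsArtinianRing R]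
    (Λ : Type v) [Ring Λ] [Algebra R Λ] [Module.Finite R Λ]
    (hΛ : IsAuslanderRegular Λ) (n : ℕ) (hn : globalDimension Λ = n) :
    (1 ≤ n → ∃ S₁ : ModuleCat.{v} Λ, IsSimpleModule Λ S₁ ∧
      projectiveDimension S₁ = ((n - 1 : ℕ) : WithBot ℕ∞)) ∧
    (∃ S₂ : ModuleCat.{v} Λ, IsSimpleModule Λ S₂ ∧ projectiveDimension S₂ = n) := by
  have : IsArtinianRing Λ := .of_finite R Λ
  obtain ⟨-, -, J, hJ⟩ := hΛ.1 n
  exact proposition3p6_general J hn fun i hi ↦ hJ i (by lia)
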